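/- Let $M$ be a closed (compact, without boundary) connected smooth $n$-dimensional manifold and let $g$ be a smooth pseudo-Riemannian metric on $M$ of indefinite signature, i.e. for no constant $c$ is the metric $c\cdot g$ Riemannian. Suppose that $g$ is light-line-complete: every affinely parametrized geodesic $\gamma$ with $g(\dot\gamma,\dot\gamma)=0$, defined on an open interval, extends to such a geodesic defined on all of $\mathbb{R}$. Let $p\ge 0$ be an integer and let $\lambda(s,\sigma)$ be arbitrary real numbers, for integers $1\le s\le\frac{p+1}{2}$ and permutations $\sigma\in S_{p+1}$. Then every function $f:M\to\mathbb{R}$ of class $C^{p+1}$ satisfying Gallot's equation $E_p$, $$D^{p+1}f(Y_1,\dots,Y_{p+1})+\sum_{1\le s\le\frac{p+1}{2}}\ \sum_{\sigma\in S_{p+1}}\lambda(s,\sigma)\,\bigl(g^{s}\otimes D^{p+1-2s}f\bigr)(Y_{\sigma(1)},\dots,Y_{\sigma(p+1)})=0$$ for all vector fields $Y_1,\dots,Y_{p+1}$ on $M$, is constant. Here $D^k$ denotes the $k$-th covariant derivative with respect to the Levi-Civita connection of $g$, with $D^0f=f$ and $D^kf(Y_1,\dots,Y_k)=\sum Y_1^{i_1}\cdots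 Y_k^{i_k}\,\nabla_{i_k}\cdots\nabla_{i_1}f$, and $g^s\otimes D^{p+1-2s}f$ evaluated on $(Z_1,\dots,Z_{p+1})$ is $g(Z_1,Z_2)\cdots g(Z_{2s-1},Z_{2s})\,D^{p+1-2s}f(Z_{2s+1},\dots,Z_{p+1})$. -/

import Mathlib

open scoped Manifold ContDiff

-- Without this line, instance search on `EuclideanSpace ℝ (Fin n)` finds its standard structure
-- of a manifold (`chartedSpaceSelf`) wrapped in `TopCat.of`.
attribute [-instance] TopCat.of.chartedSpace TopCat.of.hasGroupoid

/-- A smooth pseudo-Riemannian metric on an `n`-dimensional smooth manifold `M` (without boundary):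
a symmetric nondegenerate bilinear form on every tangent space, depending smoothly on the point. -/
structure PseudoRiemannianMetric (n : ℕ) (M : Type*) [TopologicalSpace M]
    [ChartedSpace (EuclideanSpace ℝ (Fin n)) M] [IsManifold (𝓡 n) ∞ M] where
  /-- The bilinear form on the tangent space at `x`. -/
  val (x : M) : TangentSpace (𝓡 n) x →L[ℝ] TangentSpace (𝓡 n) x →L[ℝ] ℝ
  symm (x : M) (v w : TangentSpace (𝓡 n) x) : val x v w = val x w v
  nondegenerate (x : M) (v : TangentSpace (𝓡 n) x) (hv : ∀ w, val x v w = 0) : v = 0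
  contMDiff : ContMDiff (𝓡 n)
    ((𝓡 n).prod 𝓘(ℝ, EuclideanSpace ℝ (Fin n) →L[ℝ] EuclideanSpace ℝ (Fin n) →L[ℝ] ℝ)) ∞
    (fun x ↦ Bundle.TotalSpace.mk'
      (EuclideanSpace ℝ (Fin n) →L[ℝ] EuclideanSpace ℝ (Fin n) →L[ℝ] ℝ) x (val x))

/-- The `i`-th partial derivative of a function on `ℝⁿ`. -/
noncomputable def partialDeriv {n : ℕ} (i : Fin n) (F : EuclideanSpace ℝ (Fin n) → ℝ)
    (y : EuclideanSpace ℝ (Fin n)) : ℝ :=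
  fderiv ℝ F y (EuclideanSpace.single i 1)

/-- The vector `(v^1, …, v^n)` of the components, in the chart `e`, of a tangent vector `v` at
`x`. -/
noncomputable def coordVector {n : ℕ} {M : Type*} [TopologicalSpace M]
    [ChartedSpace (EuclideanSpace ℝ (Fin n)) M]
    (e : OpenPartialHomeomorph M (EuclideanSpace ℝ (Fin n))) (x : M) (v : TangentSpace (𝓡 n) x) :
    EuclideanSpace ℝ (Fin n) :=
  mfderiv (𝓡 n) (𝓡 n) e x v

namespace PseudoRiemannianMetric

variable {n : ℕ} {M : Type*} [TopologicalSpace M]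
  [ChartedSpace (EuclideanSpace ℝ (Fin n)) M] [IsManifold (𝓡 n) ∞ M]

/-- The metric is indefinite: for no constant `c` is `c • g` a Riemannian metric. -/
def IsIndefinite (g : PseudoRiemannianMetric n M) : Prop :=
  ∀ c : ℝ, ¬ ∀ (x : M) (v : TangentSpace (𝓡 n) x), v ≠ 0 → 0 < c * g.val x v v

/-- The matrix `g_{ij}` of the metric in the chart `e`, as a function of the coordinates
`y ∈ e.target`: `g_{ij}(y) = g(∂_i, ∂_j)` at the point `e.symm y`. -/
noncomputable def coordMatrix (g : PseudoRiemannianMetric n M)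
    (e : OpenPartialHomeomorph M (EuclideanSpace ℝ (Fin n))) (y : EuclideanSpace ℝ (Fin n)) :
    Matrix (Fin n) (Fin n) ℝ :=
  Matrix.of fun i j ↦ g.val (e.symm y)
    (mfderiv (𝓡 n) (𝓡 n) e.symm y (EuclideanSpace.single i (1 : ℝ)))
    (mfderiv (𝓡 n) (𝓡 n) e.symm y (EuclideanSpace.single j (1 : ℝ)))

/-- The Christoffel symbols of the Levi-Civita connection in the chart `e`:
`Γ^i_{jk} = 1/2 ∑_h g^{ih} (∂_k g_{jh} + ∂_j g_{hk} - ∂_h g_{jk})`. -/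
noncomputable def christoffel (g : PseudoRiemannianMetric n M)
    (e : OpenPartialHomeomorph M (EuclideanSpace ℝ (Fin n))) (i j k : Fin n)
    (y : EuclideanSpace ℝ (Fin n)) : ℝ :=
  1 / 2 * ∑ h, (g.coordMatrix e y)⁻¹ i h *
    (partialDeriv k (fun z ↦ g.coordMatrix e z j h) y
      + partialDeriv j (fun z ↦ g.coordMatrix e z h k) y
      - partialDeriv h (fun z ↦ g.coordMatrix e z j k) y)

/-- The components `∇_{i_k} ⋯ ∇_{i_2} ∇_{i_1} f` of the `k`-th covariant derivative of `f` in the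
chart `e`, as functions of the coordinates:
`∇_j T_{i_1 … i_k} = ∂_j T_{i_1 … i_k} - ∑_s ∑_h Γ^h_{j i_s} T_{i_1 … h … i_k}`.
The index of the last differentiation is the last one. -/
noncomputable def covDerivCoord (g : PseudoRiemannianMetric n M)
    (e : OpenPartialHomeomorph M (EuclideanSpace ℝ (Fin n))) (f : M → ℝ) :
    (k : ℕ) → (Fin k → Fin n) → EuclideanSpace ℝ (Fin n) → ℝ
  | 0, _, y => f (e.symm y)
  | k + 1, I, y =>
      partialDeriv (I (Fin.last k)) (covDerivCoord g e f k (Fin.init I)) y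
        - ∑ s : Fin k, ∑ h : Fin n, g.christoffel e h (I (Fin.last k)) (I s.castSucc) y
            * covDerivCoord g e f k (Function.update (Fin.init I) s h) y

/-- The `k`-th covariant derivative `D^k f` at `x`, evaluated on tangent vectors `Y_1, …, Y_k` at
`x` and computed in a chart `e` around `x`:
`D^k f (Y_1, …, Y_k) = ∑ Y_1^{i_1} ⋯ Y_k^{i_k} ∇_{i_k} ⋯ ∇_{i_1} f`. -/
noncomputable def covDeriv (g : PseudoRiemannianMetric n M)
    (e : OpenPartialHomeomorph M (EuclideanSpace ℝ (Fin n))) (f : M → ℝ) (k : ℕ) (x : M)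
    (Y : Fin k → TangentSpace (𝓡 n) x) : ℝ :=
  ∑ I : Fin k → Fin n, g.covDerivCoord e f k I (e x) *
    ∏ s, coordVector e x (Y s) (I s)

/-- The tensor `g^s ⊗ D^{m-2s} f` at `x`, evaluated on `m ≥ 2 s` tangent vectors:
`g(Z_1, Z_2) ⋯ g(Z_{2s-1}, Z_{2s}) · D^{m-2s} f (Z_{2s+1}, …, Z_m)`
(the value for `m < 2 s` is irrelevant). -/
noncomputable def metricPowTensor (g : PseudoRiemannianMetric n M)
    (e : OpenPartialHomeomorph M (EuclideanSpace ℝ (Fin n))) (f : M → ℝ) (s m : ℕ) (x : M)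
    (Z : Fin m → TangentSpace (𝓡 n) x) : ℝ :=
  if hs : 2 * s ≤ m then
    (∏ i : Fin s, g.val x (Z ⟨2 * i, by omega⟩) (Z ⟨2 * i + 1, by omega⟩)) *
      g.covDeriv e f (m - 2 * s) x (fun j ↦ Z ⟨2 * s + j, by omega⟩)
  else 0

/-- `f` is a solution of the equation `E_p` with coefficients `lam s σ`: `f` is of class `C^{p+1}`
and, at every point and for all tangent vectors `Y_1, …, Y_{p+1}` there,
`D^{p+1} f (Y_1, …, Y_{p+1})
  + ∑_{1 ≤ s ≤ (p+1)/2} ∑_σ lam(s, σ) (g^s ⊗ D^{p+1-2s} f) (Y_{σ(1)}, …, Y_{σ(p+1)}) = 0`.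
The covariant derivatives may be computed in any chart of the smooth structure around the point. -/
def IsGallotSolution (g : PseudoRiemannianMetric n M) (p : ℕ)
    (lam : ℕ → Equiv.Perm (Fin (p + 1)) → ℝ) (f : M → ℝ) : Prop :=
  ContMDiff (𝓡 n) 𝓘(ℝ, ℝ) (p + 1 : ℕ) f ∧
  ∀ e ∈ IsManifold.maximalAtlas (𝓡 n) ∞ M, ∀ x ∈ e.source,
    ∀ Y : Fin (p + 1) → TangentSpace (𝓡 n) x,
      g.covDeriv e f (p + 1) x Y
        + ∑ s ∈ Finset.Icc 1 ((p + 1) / 2), ∑ σ : Equiv.Perm (Fin (p + 1)),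
            lam s σ * g.metricPowTensor e f s (p + 1) x (fun a ↦ Y (σ a)) = 0

/-- In the chart `e`, the curve `γ` satisfies the geodesic equation at time `t`:
`(γ^i)'' + ∑ Γ^i_{jk} (γ^j)' (γ^k)' = 0`. -/
def GeodesicEqAt (g : PseudoRiemannianMetric n M)
    (e : OpenPartialHomeomorph M (EuclideanSpace ℝ (Fin n))) (γ : ℝ → M) (t : ℝ) : Prop :=
  ∀ i, deriv (deriv fun τ ↦ e (γ τ) i) t
    + ∑ j, ∑ k, g.christoffel e i j k (e (γ t)) *
        deriv (fun τ ↦ e (γ τ) j) t * deriv (fun τ ↦ e (γ τ) k) t = 0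

/-- `γ` is an (affinely parametrized) geodesic on the open set `J` of times: a `C^2` curve
satisfying the geodesic equation in local coordinates around each of its points. -/
def IsGeodesicOn (g : PseudoRiemannianMetric n M) (γ : ℝ → M) (J : Set ℝ) : Prop :=
  ContMDiffOn 𝓘(ℝ, ℝ) (𝓡 n) 2 γ J ∧
  ∀ t₀ ∈ J, ∃ e ∈ IsManifold.maximalAtlas (𝓡 n) ∞ M, γ t₀ ∈ e.source ∧
    ∀ᶠ t in nhds t₀, g.GeodesicEqAt e γ t

/-- `γ` is a light-line geodesic on the open set `J` of times: a geodesic whose velocity vector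
`γ'` satisfies `g(γ', γ') = 0`. -/
def IsLightLineGeodesicOn (g : PseudoRiemannianMetric n M) (γ : ℝ → M) (J : Set ℝ) : Prop :=
  g.IsGeodesicOn γ J ∧
  ∀ t ∈ J, g.val (γ t) (mfderiv 𝓘(ℝ, ℝ) (𝓡 n) γ t (1 : ℝ))
    (mfderiv 𝓘(ℝ, ℝ) (𝓡 n) γ t (1 : ℝ)) = 0

/-- The metric is light-line-complete: every light-line geodesic defined on an open interval `J`
extends to a light-line geodesic defined on the whole real line. -/
def IsLightLineComplete (g : PseudoRiemannianMetric n M) : Prop :=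
  ∀ (J : Set ℝ) (γ : ℝ → M), IsOpen J → J.OrdConnected → J.Nonempty →
    g.IsLightLineGeodesicOn γ J →
    ∃ γ' : ℝ → M, g.IsLightLineGeodesicOn γ' Set.univ ∧ Set.EqOn γ' γ J

end PseudoRiemannianMetric

/-! On a null vector v every term of the equation with s ≥ 1 contains a factor g(v, v), so the
equation collapses to D^{p+1} f(v, …, v) = 0, whatever the coefficients. Along a geodesic γ the k-th
derivative of f ∘ γ is D^k f(γ', …, γ') (`eventually_iteratedDeriv_eq_covDeriv`). On a complete
light-line geodesic f ∘ γ is therefore a polynomial in the affine parameter. Compactness of M bounds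
it, and a bounded polynomial is constant (`IsGallotSolution.eq_along_lightLine`).

Every null vector is the initial velocity of a light-line geodesic (`exists_isLightLineGeodesicOn`),
which completeness extends to all of ℝ, so df vanishes on null vectors. For c ≠ 0, positive
definiteness of c • g is an open and closed condition (`isClopen_posDef`), so on a connected M
indefiniteness forces g to take both signs at every point. A linear form that kills the null vectors
of such a form is zero (`LinearMap.BilinForm.eq_zero_of_null`). Hence df = 0, and f is constant
because M is connected. -/

/-! ### Calculus in coordinates -/

theorem partialDeriv_contDiffOn {n : ℕ} {i : Fin n} {F : EuclideanSpace ℝ (Fin n) → ℝ}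
    {U : Set (EuclideanSpace ℝ (Fin n))} (hU : IsOpen U) {m k : WithTop ℕ∞}
    (hF : ContDiffOn ℝ k F U) (hmk : m + 1 ≤ k) : ContDiffOn ℝ m (partialDeriv i F) U := by
  unfold partialDeriv
  exact (hF.fderiv_of_isOpen hU hmk).clm_apply contDiffOn_const

theorem hasDerivAt_euclidean_apply {n : ℕ} {c : ℝ → EuclideanSpace ℝ (Fin n)}
    {w : EuclideanSpace ℝ (Fin n)} {t : ℝ} (hc : HasDerivAt c w t) (i : Fin n) :
    HasDerivAt (fun τ ↦ c τ i) (w i) t :=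
  (EuclideanSpace.proj i : EuclideanSpace ℝ (Fin n) →L[ℝ] ℝ).hasFDerivAt.comp_hasDerivAt t hc

theorem hasDerivAt_euclidean_of_apply {n : ℕ} {c : ℝ → EuclideanSpace ℝ (Fin n)}
    {w : EuclideanSpace ℝ (Fin n)} {t : ℝ} (h : ∀ i, HasDerivAt (fun τ ↦ c τ i) (w i) t) :
    HasDerivAt c w t := by
  have h1 : HasDerivAt (fun τ ↦ (c τ).ofLp) w.ofLp t := hasDerivAt_pi.2 h
  exact ((EuclideanSpace.equiv (Fin n) ℝ).symm.hasFDerivAt (x := (c t).ofLp)).comp_hasDerivAt t h1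

theorem hasDerivAt_comp_partialDeriv {n : ℕ} {F : EuclideanSpace ℝ (Fin n) → ℝ}
    {c : ℝ → EuclideanSpace ℝ (Fin n)} {w : EuclideanSpace ℝ (Fin n)} {t : ℝ}
    (hF : DifferentiableAt ℝ F (c t)) (hc : HasDerivAt c w t) :
    HasDerivAt (fun τ ↦ F (c τ)) (∑ i, partialDeriv i F (c t) * w i) t := by
  convert! hF.hasFDerivAt.comp_hasDerivAt t hc using 1
  conv_rhs => rw [← (EuclideanSpace.basisFun (Fin n) ℝ).sum_repr w]
  simp [partialDeriv, mul_comm]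

/-! ### Bounded polynomials and null vectors of bilinear forms -/

open Filter Topology in
/-- A bounded function with vanishing `(p+1)`-st derivative is constant. -/
theorem eq_of_iteratedDeriv_succ_eq_zero_of_bounded {p : ℕ} {F : ℝ → ℝ}
    (hd : ∀ k ≤ p, Differentiable ℝ (iteratedDeriv k F)) (h0 : ∀ t, iteratedDeriv (p + 1) F t = 0)
    {C : ℝ} (hC : ∀ t, |F t| ≤ C) (s t : ℝ) : F s = F t := by
  have hint (Q : Polynomial ℝ) : ∃ P, Polynomial.derivative P = Q := by
    induction Q using Polynomial.induction_on' with
    | add P Q hP hQ =>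
      obtain ⟨⟨P, rfl⟩, ⟨Q, rfl⟩⟩ := And.intro hP hQ
      exact ⟨P + Q, Polynomial.derivative_add⟩
    | monomial k a =>
      refine ⟨Polynomial.monomial (k + 1) (a / (k + 1)), ?_⟩
      rw [Polynomial.derivative_monomial]
      congr 1
      push_cast
      field_simp
  -- No degree bound is needed, since every nonconstant polynomial is unbounded. In the induction, F
  -- differs by a constant from an antiderivative of the polynomial `deriv F`.
  have hpoly : ∃ P : Polynomial ℝ, ∀ t, F t = P.eval t := by
    clear hC
    induction p generalizing F with
    | zero =>
      refine ⟨Polynomial.C (F 0), fun t ↦ ?_⟩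
      simp only [zero_add, iteratedDeriv_one] at h0
      have := hd 0 le_rfl
      rw [iteratedDeriv_zero] at this
      simpa using is_const_of_deriv_eq_zero this h0 t 0
    | succ p ih =>
      obtain ⟨Q, hQ⟩ := ih (F := deriv F)
        (fun k hk ↦ by rw [← iteratedDeriv_succ']; exact hd _ (by omega))
        (fun t ↦ by rw [← iteratedDeriv_succ']; exact h0 t)
      obtain ⟨P, rfl⟩ := hint Q
      refine ⟨P + Polynomial.C (F 0 - P.eval 0), fun t ↦ ?_⟩
      have hF : Differentiable ℝ F := by simpa using hd 0 (by omega)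
      have := is_const_of_deriv_eq_zero (f := fun t ↦ F t - P.eval t) (hF.sub P.differentiable)
        (fun x ↦ by rw [deriv_fun_sub (hF x) P.differentiableAt, hQ, Polynomial.deriv, sub_self])
        t 0
      simp only [Polynomial.eval_add, Polynomial.eval_C]
      linarith
  obtain ⟨P, hP⟩ := hpoly
  by_cases hdeg : 0 < P.degree
  · obtain ⟨x, hx⟩ := ((P.abs_tendsto_atTop hdeg).eventually_gt_atTop C).exists
    exact absurd (hC x) (by rw [hP]; exact not_le.2 hx)
  · rw [hP, hP, Polynomial.eq_C_of_degree_le_zero (not_lt.1 hdeg)]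
    simp

/-- A linear form vanishing on the null vectors of an indefinite symmetric bilinear form vanishes on
every vector on which the form is positive. -/
theorem LinearMap.BilinForm.apply_eq_zero_of_null {V : Type*} [AddCommGroup V] [Module ℝ V]
    (B : LinearMap.BilinForm ℝ V) (hB : ∀ v w, B v w = B w v) (L : V →ₗ[ℝ] ℝ)
    (hL : ∀ v, B v v = 0 → L v = 0) {a b : V} (hab : B a a * B b b < 0) : L b = 0 := by
  have hb : B b b ≠ 0 := fun h ↦ by simp [h] at hab
  -- D is the root of the reduced discriminant of B on the plane of a and b. The two null directions
  -- there are B(b,b) a + (±D - B(a,b)) b, and subtracting the values of L on them leaves a multiple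
  -- of D · L b.
  set D := √(B a b ^ 2 - B a a * B b b) with hD
  have hpos : 0 < B a b ^ 2 - B a a * B b b := by nlinarith [sq_nonneg (B a b)]
  have hD2 : D ^ 2 = B a b ^ 2 - B a a * B b b := Real.sq_sqrt hpos.le
  have hD0 : 0 < D := Real.sqrt_pos.2 hpos
  have hroot (s : ℝ) (hs : s ^ 2 = B a b ^ 2 - B a a * B b b) :
      B b b * L a + (s - B a b) * L b = 0 := by
    have h : B (B b b • a + (s - B a b) • b) (B b b • a + (s - B a b) • b) = 0 := by
      simp only [map_add, map_smul, LinearMap.add_apply, LinearMap.smul_apply, smul_eq_mul, hB b a]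
      linear_combination B b b * hs
    simpa using hL _ h
  have h1 := hroot D hD2
  have h2 := hroot (-D) (by rw [neg_sq, hD2])
  have : D * L b = 0 := by linarith
  exact (mul_eq_zero.1 this).resolve_left hD0.ne'

/-- A linear form vanishing on the null vectors of an indefinite symmetric bilinear form is zero. -/
theorem LinearMap.BilinForm.eq_zero_of_null {V : Type*} [AddCommGroup V] [Module ℝ V]
    (B : LinearMap.BilinForm ℝ V) (hB : ∀ v w, B v w = B w v) (L : V →ₗ[ℝ] ℝ)
    (hL : ∀ v, B v v = 0 → L v = 0) {a b : V} (ha : B a a < 0) (hb : 0 < B b b) : L = 0 := by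
  ext v
  rcases lt_trichotomy (B v v) 0 with h | h | h
  · exact B.apply_eq_zero_of_null hB L hL (mul_neg_of_pos_of_neg hb h)
  · exact hL v h
  · exact B.apply_eq_zero_of_null hB L hL (mul_neg_of_neg_of_pos ha h)

namespace PseudoRiemannianMetric

variable {n : ℕ} {M : Type*} [TopologicalSpace M]
  [ChartedSpace (EuclideanSpace ℝ (Fin n)) M] [IsManifold (𝓡 n) ∞ M]

/-! ### The metric and covariant derivatives in a chart -/

theorem contMDiffOn_coordVectorField {e : OpenPartialHomeomorph M (EuclideanSpace ℝ (Fin n))}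
    (he : e ∈ IsManifold.maximalAtlas (𝓡 n) ∞ M) (v : EuclideanSpace ℝ (Fin n)) :
    ContMDiffOn (𝓡 n) (𝓡 n).tangent ∞ (fun y ↦ (Bundle.TotalSpace.mk' (EuclideanSpace ℝ (Fin n))
      (e.symm y) (mfderiv (𝓡 n) (𝓡 n) e.symm y v) : TangentBundle (𝓡 n) M)) e.target := by
  have h := (contMDiffOn_symm_of_mem_maximalAtlas he).contMDiffOn_tangentMapWithin
    (m := ∞) (by simp) e.open_target.uniqueMDiffOn
  have h2 : ContMDiff (𝓡 n) (𝓡 n).tangent ∞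
      (fun y ↦ (⟨y, v⟩ : TangentBundle (𝓡 n) (EuclideanSpace ℝ (Fin n)))) := by
    intro x
    rw [Bundle.contMDiffAt_totalSpace]
    refine ⟨contMDiffAt_id, ?_⟩
    simp
    exact contMDiffAt_const
  refine (h.comp h2.contMDiffOn (fun y hy ↦ hy)).congr fun y hy ↦ ?_
  simp [tangentMapWithin, mfderivWithin_of_isOpen e.open_target hy]

theorem contDiffOn_coordMatrix (g : PseudoRiemannianMetric n M)
    {e : OpenPartialHomeomorph M (EuclideanSpace ℝ (Fin n))}
    (he : e ∈ IsManifold.maximalAtlas (𝓡 n) ∞ M) (i j : Fin n) :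
    ContDiffOn ℝ ∞ (fun y ↦ g.coordMatrix e y i j) e.target := by
  rw [← contMDiffOn_iff_contDiffOn]
  have : ContMDiffOn (𝓡 n) ((𝓡 n).prod 𝓘(ℝ, ℝ)) ∞
      (fun y ↦ Bundle.TotalSpace.mk' ℝ (E := Bundle.Trivial M ℝ) (e.symm y)
        (g.coordMatrix e y i j)) e.target := by
    apply ContMDiffOn.clm_bundle_apply₂ (F₁ := EuclideanSpace ℝ (Fin n))
      (F₂ := EuclideanSpace ℝ (Fin n))
    · exact g.contMDiff.comp_contMDiffOn (contMDiffOn_symm_of_mem_maximalAtlas he)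
    · exact contMDiffOn_coordVectorField he _
    · exact contMDiffOn_coordVectorField he _
  intro y hy
  exact (Bundle.contMDiffWithinAt_totalSpace.1 (this y hy)).2


theorem coordMatrix_symm (g : PseudoRiemannianMetric n M)
    (e : OpenPartialHomeomorph M (EuclideanSpace ℝ (Fin n))) (y : EuclideanSpace ℝ (Fin n))
    (i j : Fin n) : g.coordMatrix e y i j = g.coordMatrix e y j i :=
  g.symm _ _ _

/-- The inner product of two vectors expressed in coordinates. -/
theorem sum_coordMatrix_mul (g : PseudoRiemannianMetric n M)
    (e : OpenPartialHomeomorph M (EuclideanSpace ℝ (Fin n))) (y v w : EuclideanSpace ℝ (Fin n)) :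
    ∑ i, ∑ j, g.coordMatrix e y i j * v i * w j =
      g.val (e.symm y) (mfderiv (𝓡 n) (𝓡 n) e.symm y v) (mfderiv (𝓡 n) (𝓡 n) e.symm y w) := by
  have key (v : EuclideanSpace ℝ (Fin n)) : (mfderiv (𝓡 n) (𝓡 n) e.symm y v :
      TangentSpace (𝓡 n) (e.symm y)) = ∑ i, v i •
        (mfderiv (𝓡 n) (𝓡 n) e.symm y (EuclideanSpace.single i (1 : ℝ))) := by
    conv_lhs => rw [← (EuclideanSpace.basisFun (Fin n) ℝ).sum_repr v]
    erw [map_sum]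
    refine Finset.sum_congr rfl fun i _ ↦ ?_
    erw [map_smul]
    simp
  rw [key v, key w]
  simp only [map_sum, map_smul, sum_apply, smul_apply,
    smul_eq_mul, coordMatrix, Matrix.of_apply, Finset.mul_sum]
  rw [Finset.sum_comm]
  refine Finset.sum_congr rfl fun i _ ↦ Finset.sum_congr rfl fun j _ ↦ by ring

omit [IsManifold (𝓡 n) ∞ M] in
theorem mdifferentiable_of_mem_maximalAtlas
    {e : OpenPartialHomeomorph M (EuclideanSpace ℝ (Fin n))}
    (he : e ∈ IsManifold.maximalAtlas (𝓡 n) ∞ M) : e.MDifferentiable (𝓡 n) (𝓡 n) :=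
  ⟨(contMDiffOn_of_mem_maximalAtlas he).mdifferentiableOn (by simp),
    (contMDiffOn_symm_of_mem_maximalAtlas he).mdifferentiableOn (by simp)⟩

omit [IsManifold (𝓡 n) ∞ M] in
theorem mfderiv_symm_coordVector {e : OpenPartialHomeomorph M (EuclideanSpace ℝ (Fin n))}
    (he : e ∈ IsManifold.maximalAtlas (𝓡 n) ∞ M) {x : M} (hx : x ∈ e.source)
    (v : TangentSpace (𝓡 n) x) :
    mfderiv (𝓡 n) (𝓡 n) e.symm (e x) (coordVector e x v) = v := by
  exact DFunLike.congr_fun ((mdifferentiable_of_mem_maximalAtlas he).symm_comp_deriv hx) v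

omit [IsManifold (𝓡 n) ∞ M] in
theorem coordVector_mfderiv_symm {e : OpenPartialHomeomorph M (EuclideanSpace ℝ (Fin n))}
    (he : e ∈ IsManifold.maximalAtlas (𝓡 n) ∞ M) {y : EuclideanSpace ℝ (Fin n)} (hy : y ∈ e.target)
    (v : EuclideanSpace ℝ (Fin n)) :
    coordVector e (e.symm y) (mfderiv (𝓡 n) (𝓡 n) e.symm y v) = v := by
  exact DFunLike.congr_fun ((mdifferentiable_of_mem_maximalAtlas he).comp_symm_deriv hy) v

/-- A kernel vector of the matrix would be orthogonal to the whole tangent space, against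
nondegeneracy. -/
theorem det_coordMatrix_ne_zero (g : PseudoRiemannianMetric n M)
    {e : OpenPartialHomeomorph M (EuclideanSpace ℝ (Fin n))}
    (he : e ∈ IsManifold.maximalAtlas (𝓡 n) ∞ M) {y : EuclideanSpace ℝ (Fin n)}
    (hy : y ∈ e.target) : (g.coordMatrix e y).det ≠ 0 := by
  intro h
  obtain ⟨v, hv, hv'⟩ := Matrix.exists_mulVec_eq_zero_iff.2 h
  have h0 : mfderiv (𝓡 n) (𝓡 n) e.symm y (WithLp.toLp 2 v : EuclideanSpace ℝ (Fin n)) = 0 := by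
    refine g.nondegenerate _ _ fun w ↦ ?_
    obtain ⟨w', rfl⟩ : ∃ w' : EuclideanSpace ℝ (Fin n),
        mfderiv (𝓡 n) (𝓡 n) e.symm y w' = w := by
      have := mfderiv_symm_coordVector he (e.map_target hy) w
      rw [e.right_inv hy] at this
      exact ⟨_, this⟩
    rw [g.symm, ← sum_coordMatrix_mul]
    refine Finset.sum_eq_zero fun i _ ↦ ?_
    have := congrFun hv' i
    simp only [Matrix.mulVec, dotProduct, Pi.zero_apply] at this
    simp only [mul_right_comm _ (w' i)]
    rw [← Finset.sum_mul, this, zero_mul]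
  have := coordVector_mfderiv_symm he hy (WithLp.toLp 2 v)
  rw [h0, coordVector, map_zero] at this
  exact hv (by ext i; exact (congrArg (fun z : EuclideanSpace ℝ (Fin n) ↦ z i) this).symm)

/-- Cramer's rule: the entries of the adjugate and the determinant are polynomials in the g_{ij}. -/
theorem contDiffOn_inv_coordMatrix (g : PseudoRiemannianMetric n M)
    {e : OpenPartialHomeomorph M (EuclideanSpace ℝ (Fin n))}
    (he : e ∈ IsManifold.maximalAtlas (𝓡 n) ∞ M) (i j : Fin n) :
    ContDiffOn ℝ ∞ (fun y ↦ (g.coordMatrix e y)⁻¹ i j) e.target := by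
  have hdet (A : EuclideanSpace ℝ (Fin n) → Matrix (Fin n) (Fin n) ℝ)
      (hA : ∀ i j, ContDiffOn ℝ ∞ (fun y ↦ A y i j) e.target) :
      ContDiffOn ℝ ∞ (fun y ↦ (A y).det) e.target := by
    simp only [Matrix.det_apply]
    exact ContDiffOn.sum fun σ _ ↦ (contDiffOn_prod fun i _ ↦ hA _ _).const_smul _
  simp only [Matrix.inv_def, Matrix.smul_apply, Ring.inverse_eq_inv', smul_eq_mul,
    Matrix.adjugate_apply]
  refine ((hdet _ (g.contDiffOn_coordMatrix he)).inv
    fun y hy ↦ g.det_coordMatrix_ne_zero he hy).mul (hdet _ fun k l ↦ ?_)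
  simp only [Matrix.updateRow_apply]
  split_ifs
  · exact contDiffOn_const
  · exact g.contDiffOn_coordMatrix he _ _

theorem contDiffOn_christoffel (g : PseudoRiemannianMetric n M)
    {e : OpenPartialHomeomorph M (EuclideanSpace ℝ (Fin n))}
    (he : e ∈ IsManifold.maximalAtlas (𝓡 n) ∞ M) (i j k : Fin n) :
    ContDiffOn ℝ ∞ (g.christoffel e i j k) e.target := by
  have h (a b c : Fin n) :
      ContDiffOn ℝ ∞ (partialDeriv a fun z ↦ g.coordMatrix e z b c) e.target :=
    partialDeriv_contDiffOn e.open_target (g.contDiffOn_coordMatrix he b c) (by simp)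
  exact contDiffOn_const.mul (ContDiffOn.sum fun h' _ ↦
    (g.contDiffOn_inv_coordMatrix he _ _).mul (((h _ _ _).add (h _ _ _)).sub (h _ _ _)))

/-- Each covariant derivative costs one order of smoothness; the spare order r is what the induction
on k consumes. -/
theorem contDiffOn_covDerivCoord (g : PseudoRiemannianMetric n M)
    {e : OpenPartialHomeomorph M (EuclideanSpace ℝ (Fin n))}
    (he : e ∈ IsManifold.maximalAtlas (𝓡 n) ∞ M) {f : M → ℝ} (k r : ℕ)
    (hf : ContMDiff (𝓡 n) 𝓘(ℝ, ℝ) (k + r : ℕ) f) (I : Fin k → Fin n) :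
    ContDiffOn ℝ r (g.covDerivCoord e f k I) e.target := by
  induction k generalizing r with
  | zero =>
    rw [← contMDiffOn_iff_contDiffOn]
    rw [zero_add] at hf
    exact hf.comp_contMDiffOn ((contMDiffOn_symm_of_mem_maximalAtlas he).of_le (by
      exact_mod_cast le_top))
  | succ k ih =>
    refine (partialDeriv_contDiffOn e.open_target (ih (r + 1) (by
      rwa [show k + (r + 1) = k + 1 + r by ring]) _) (by simp)).sub
      (ContDiffOn.sum fun s _ ↦ ContDiffOn.sum fun h _ ↦
        ((g.contDiffOn_christoffel he _ _ _).of_le (by exact_mod_cast le_top)).mul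
        (ih r (hf.of_le (by norm_cast; omega)) _))

/-! ### Differentiation along geodesics -/

/-- The acceleration `-Γ^i_{jk}(y) v^j v^k` of a geodesic in the chart `e` passing through `y` with
velocity `v`. -/
noncomputable def geodesicAccel (g : PseudoRiemannianMetric n M)
    (e : OpenPartialHomeomorph M (EuclideanSpace ℝ (Fin n))) (y v : EuclideanSpace ℝ (Fin n)) :
    EuclideanSpace ℝ (Fin n) :=
  WithLp.toLp 2 fun i ↦ -∑ j, ∑ k, g.christoffel e i j k y * v j * v k

theorem geodesicAccel_apply (g : PseudoRiemannianMetric n M)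
    (e : OpenPartialHomeomorph M (EuclideanSpace ℝ (Fin n))) (y v : EuclideanSpace ℝ (Fin n))
    (i : Fin n) :
    g.geodesicAccel e y v i = -∑ j, ∑ k, g.christoffel e i j k y * v j * v k := rfl

/-- The right side is the product-rule derivative of D^k f(v, …, v) when y moves with velocity v and
v changes with the geodesic acceleration: after contraction, the Christoffel corrections in the
covariant derivative are precisely the acceleration terms. -/
theorem sum_covDerivCoord_succ (g : PseudoRiemannianMetric n M)
    (e : OpenPartialHomeomorph M (EuclideanSpace ℝ (Fin n))) (f : M → ℝ) (k : ℕ)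
    (y v : EuclideanSpace ℝ (Fin n)) :
    ∑ J : Fin (k + 1) → Fin n, g.covDerivCoord e f (k + 1) J y * ∏ s, v (J s) =
      ∑ I : Fin k → Fin n, ((∑ j, partialDeriv j (g.covDerivCoord e f k I) y * v j) * ∏ s, v (I s)
        + g.covDerivCoord e f k I y *
          ∑ s, (∏ s' ∈ Finset.univ.erase s, v (I s')) * g.geodesicAccel e y v (I s)) := by
  -- Exchanging the index I s with the summation index h is an involution on the pairs (I, h). It
  -- moves the upper index of Γ onto the tensor slot, as the acceleration requires.
  have hswap (j : Fin n) (s : Fin k) :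
      ∑ I : Fin k → Fin n, ∑ h : Fin n, g.christoffel e h j (I s) y *
          g.covDerivCoord e f k (Function.update I s h) y * ((∏ s, v (I s)) * v j) =
        ∑ I : Fin k → Fin n, ∑ h : Fin n, g.covDerivCoord e f k I y *
          ((∏ s' ∈ Finset.univ.erase s, v (I s')) * (g.christoffel e (I s) j h y * v j * v h)) := by
    rw [← Fintype.sum_prod_type', ← Fintype.sum_prod_type']
    let σ : (Fin k → Fin n) × Fin n → (Fin k → Fin n) × Fin n :=
      fun p ↦ (Function.update p.1 s p.2, p.1 s)
    have hσ : Function.Involutive σ := fun p ↦ by simp [σ]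
    refine Fintype.sum_equiv hσ.toPerm _ _ fun p ↦ ?_
    have hprod : ∏ s' ∈ Finset.univ.erase s, v (Function.update p.1 s p.2 s') =
        ∏ s' ∈ Finset.univ.erase s, v (p.1 s') :=
      Finset.prod_congr rfl fun s' hs' ↦ by
        rw [Function.update_of_ne (Finset.ne_of_mem_erase hs')]
    simp only [Function.Involutive.coe_toPerm, σ, hprod, Function.update_self]
    rw [← Finset.mul_prod_erase _ _ (Finset.mem_univ s)]
    ring
  rw [← (Fin.snocEquiv fun _ ↦ Fin n).sum_comp, Fintype.sum_prod_type]
  simp only [Fin.snocEquiv, Equiv.coe_fn_mk, covDerivCoord, Fin.snoc_last, Fin.init_snoc,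
    Fin.prod_univ_castSucc, Fin.snoc_castSucc, sub_mul, Finset.sum_sub_distrib,
    geodesicAccel_apply, mul_neg, Finset.sum_neg_distrib, ← sub_eq_add_neg]
  congr 1
  · rw [Finset.sum_comm]
    refine Finset.sum_congr rfl fun I _ ↦ ?_
    rw [Finset.sum_mul]
    exact Finset.sum_congr rfl fun j _ ↦ by ring
  · simp only [Finset.sum_mul, Finset.mul_sum]
    calc _ = ∑ j, ∑ s, ∑ I : Fin k → Fin n, ∑ h : Fin n, g.covDerivCoord e f k I y *
          ((∏ s' ∈ Finset.univ.erase s, v (I s')) * (g.christoffel e (I s) j h y * v j * v h)) := by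
            refine Finset.sum_congr rfl fun j _ ↦ ?_
            rw [Finset.sum_comm]
            exact Finset.sum_congr rfl fun s _ ↦ hswap j s
      _ = _ := by
            rw [Finset.sum_comm]
            conv_rhs => rw [Finset.sum_comm]
            refine Finset.sum_congr rfl fun s _ ↦ ?_
            rw [Finset.sum_comm]

/-- Along a geodesic, the derivative of `D^k f (γ', …, γ')` is `D^{k+1} f (γ', …, γ')`. -/
theorem hasDerivAt_sum_covDerivCoord (g : PseudoRiemannianMetric n M)
    {e : OpenPartialHomeomorph M (EuclideanSpace ℝ (Fin n))}
    (he : e ∈ IsManifold.maximalAtlas (𝓡 n) ∞ M) {f : M → ℝ} (k : ℕ)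
    (hf : ContMDiff (𝓡 n) 𝓘(ℝ, ℝ) (k + 1 : ℕ) f) {c w : ℝ → EuclideanSpace ℝ (Fin n)} {t : ℝ}
    (ht : c t ∈ e.target) (hc : HasDerivAt c (w t) t)
    (hw : HasDerivAt w (g.geodesicAccel e (c t) (w t)) t) :
    HasDerivAt (fun τ ↦ ∑ I : Fin k → Fin n, g.covDerivCoord e f k I (c τ) * ∏ s, w τ (I s))
      (∑ J : Fin (k + 1) → Fin n, g.covDerivCoord e f (k + 1) J (c t) * ∏ s, w t (J s)) t := by
  rw [sum_covDerivCoord_succ]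
  refine HasDerivAt.fun_sum fun I _ ↦ HasDerivAt.mul (hasDerivAt_comp_partialDeriv ?_ hc) ?_
  · exact (((g.contDiffOn_covDerivCoord he k 1 hf I).differentiableOn (by simp)) _
      ht).differentiableAt (e.open_target.mem_nhds ht)
  · exact HasDerivAt.fun_finsetProd fun s _ ↦ hasDerivAt_euclidean_apply hw (I s)

/-- Lowering the upper index cancels the inverse matrix in the Christoffel symbol, leaving only the
summand h = a. -/
theorem sum_coordMatrix_mul_christoffel (g : PseudoRiemannianMetric n M)
    {e : OpenPartialHomeomorph M (EuclideanSpace ℝ (Fin n))}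
    (he : e ∈ IsManifold.maximalAtlas (𝓡 n) ∞ M) {y : EuclideanSpace ℝ (Fin n)}
    (hy : y ∈ e.target) (a j k : Fin n) :
    ∑ i, g.coordMatrix e y a i * g.christoffel e i j k y =
      1 / 2 * (partialDeriv k (fun z ↦ g.coordMatrix e z j a) y
        + partialDeriv j (fun z ↦ g.coordMatrix e z a k) y
        - partialDeriv a (fun z ↦ g.coordMatrix e z j k) y) := by
  have hinv : g.coordMatrix e y * (g.coordMatrix e y)⁻¹ = 1 :=
    Matrix.mul_nonsing_inv _ (g.det_coordMatrix_ne_zero he hy).isUnit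
  simp only [christoffel, Finset.mul_sum]
  rw [Finset.sum_comm]
  rw [Finset.sum_eq_single_of_mem a (Finset.mem_univ a)]
  · have := congrFun (congrFun hinv a) a
    rw [Matrix.mul_apply, Matrix.one_apply_eq] at this
    rw [← one_mul (1 / 2 * _), ← this, Finset.sum_mul]
    exact Finset.sum_congr rfl fun i _ ↦ by ring
  · intro h _ hne
    have := congrFun (congrFun hinv a) h
    rw [Matrix.mul_apply, Matrix.one_apply_ne hne.symm] at this
    rw [← zero_mul (1 / 2 * (partialDeriv k (fun z ↦ g.coordMatrix e z j h) y
      + partialDeriv j (fun z ↦ g.coordMatrix e z h k) y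
      - partialDeriv h (fun z ↦ g.coordMatrix e z j k) y)), ← this, Finset.sum_mul]
    exact Finset.sum_congr rfl fun i _ ↦ by ring

/-- Contraction of the metric with the acceleration of a geodesic. -/
theorem sum_coordMatrix_mul_geodesicAccel (g : PseudoRiemannianMetric n M)
    {e : OpenPartialHomeomorph M (EuclideanSpace ℝ (Fin n))}
    (he : e ∈ IsManifold.maximalAtlas (𝓡 n) ∞ M) {y : EuclideanSpace ℝ (Fin n)}
    (hy : y ∈ e.target) (v : EuclideanSpace ℝ (Fin n)) :
    ∑ i, ∑ j, g.coordMatrix e y i j * v i * g.geodesicAccel e y v j =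
      -(1 / 2 * ∑ i, ∑ j, ∑ k, partialDeriv k (fun z ↦ g.coordMatrix e z i j) y
        * v i * v j * v k) := by
  have h1 (i : Fin n) : ∑ j, g.coordMatrix e y i j * v i * g.geodesicAccel e y v j =
      -∑ j, ∑ k, 1 / 2 * (partialDeriv k (fun z ↦ g.coordMatrix e z j i) y
        + partialDeriv j (fun z ↦ g.coordMatrix e z i k) y
        - partialDeriv i (fun z ↦ g.coordMatrix e z j k) y) * (v i * v j * v k) := by
    simp only [← g.sum_coordMatrix_mul_christoffel he hy, geodesicAccel_apply, mul_neg,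
      Finset.sum_neg_distrib, Finset.mul_sum, Finset.sum_mul]
    congr 1
    rw [Finset.sum_comm]
    refine Finset.sum_congr rfl fun j _ ↦ ?_
    rw [Finset.sum_comm]
    exact Finset.sum_congr rfl fun k _ ↦ Finset.sum_congr rfl fun l _ ↦ by ring
  have h2 : ∑ i, ∑ j, ∑ k, partialDeriv k (fun z ↦ g.coordMatrix e z j i) y * v i * v j * v k =
      ∑ i, ∑ j, ∑ k, partialDeriv k (fun z ↦ g.coordMatrix e z i j) y * v i * v j * v k := by
    refine Finset.sum_congr rfl fun i _ ↦ Finset.sum_congr rfl fun j _ ↦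
      Finset.sum_congr rfl fun k _ ↦ ?_
    simp only [g.coordMatrix_symm e _ j i]
  -- Contracted with v three times, two of the three metric derivatives agree after renaming
  -- indices. They enter with opposite signs and cancel.
  have h3 : ∑ i, ∑ j, ∑ k, partialDeriv j (fun z ↦ g.coordMatrix e z i k) y * v i * v j * v k =
      ∑ i, ∑ j, ∑ k, partialDeriv i (fun z ↦ g.coordMatrix e z j k) y * v i * v j * v k := by
    rw [Finset.sum_comm]
    refine Finset.sum_congr rfl fun i _ ↦ Finset.sum_congr rfl fun j _ ↦
      Finset.sum_congr rfl fun k _ ↦ by ring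
  simp only [h1, Finset.sum_neg_distrib]
  rw [← h2, Finset.mul_sum, ← sub_eq_zero, ← neg_eq_zero]
  have h4 := congrArg (fun z ↦ 1 / 2 * z) h3
  rw [← sub_eq_zero] at h4
  rw [← h4]
  simp only [Finset.mul_sum]
  rw [neg_sub, neg_sub_neg]
  simp only [← Finset.sum_sub_distrib]
  exact Finset.sum_congr rfl fun i _ ↦ Finset.sum_congr rfl fun j _ ↦
      Finset.sum_congr rfl fun k _ ↦ by ring

/-- Geodesics have constant speed. -/
theorem hasDerivAt_sum_coordMatrix (g : PseudoRiemannianMetric n M)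
    {e : OpenPartialHomeomorph M (EuclideanSpace ℝ (Fin n))}
    (he : e ∈ IsManifold.maximalAtlas (𝓡 n) ∞ M) {c w : ℝ → EuclideanSpace ℝ (Fin n)} {t : ℝ}
    (ht : c t ∈ e.target) (hc : HasDerivAt c (w t) t)
    (hw : HasDerivAt w (g.geodesicAccel e (c t) (w t)) t) :
    HasDerivAt (fun τ ↦ ∑ i, ∑ j, g.coordMatrix e (c τ) i j * w τ i * w τ j) 0 t := by
  have hd (i j : Fin n) : DifferentiableAt ℝ (fun y ↦ g.coordMatrix e y i j) (c t) :=
    (((g.contDiffOn_coordMatrix he i j).differentiableOn (by simp)) _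
      ht).differentiableAt (e.open_target.mem_nhds ht)
  have hw' := hasDerivAt_euclidean_apply hw
  have h := HasDerivAt.fun_sum (u := Finset.univ) fun i _ ↦
    HasDerivAt.fun_sum (u := Finset.univ) fun j _ ↦
    ((hasDerivAt_comp_partialDeriv (hd i j) hc).fun_mul (hw' i)).fun_mul (hw' j)
  convert! h using 1
  have hA := g.sum_coordMatrix_mul_geodesicAccel he ht (w t)
  -- By symmetry of g the two acceleration terms are equal. Each is minus one half of the term
  -- differentiating g_{ij}, so the total vanishes.
  have hB : ∑ i, ∑ j, g.coordMatrix e (c t) i j * g.geodesicAccel e (c t) (w t) i * w t j =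
      ∑ i, ∑ j, g.coordMatrix e (c t) i j * w t i * g.geodesicAccel e (c t) (w t) j := by
    rw [Finset.sum_comm]
    refine Finset.sum_congr rfl fun i _ ↦ Finset.sum_congr rfl fun j _ ↦ ?_
    rw [g.coordMatrix_symm]
    ring
  simp only [add_mul, Finset.sum_add_distrib, hA, hB, Finset.sum_mul]
  have hC : ∑ i, ∑ j, ∑ k, partialDeriv k (fun z ↦ g.coordMatrix e z i j) (c t) * w t k * w t i *
        w t j = ∑ i, ∑ j, ∑ k, partialDeriv k (fun z ↦ g.coordMatrix e z i j) (c t)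
        * w t i * w t j * w t k :=
    Finset.sum_congr rfl fun i _ ↦ Finset.sum_congr rfl fun j _ ↦
      Finset.sum_congr rfl fun k _ ↦ by ring
  rw [hC]
  ring

/-! ### Functions along geodesics on the manifold -/

open Filter Topology in
/-- A `C^2` curve satisfying the geodesic equation in a chart solves there the first order system
of ordinary differential equations of the geodesics. -/
theorem eventually_hasDerivAt_of_geodesicEqAt (g : PseudoRiemannianMetric n M)
    {e : OpenPartialHomeomorph M (EuclideanSpace ℝ (Fin n))}
    (he : e ∈ IsManifold.maximalAtlas (𝓡 n) ∞ M) {γ : ℝ → M} {t₀ : ℝ}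
    (hγ : ContMDiffAt 𝓘(ℝ, ℝ) (𝓡 n) 2 γ t₀) (ht₀ : γ t₀ ∈ e.source)
    (hgeo : ∀ᶠ t in 𝓝 t₀, g.GeodesicEqAt e γ t) :
    ∀ᶠ t in 𝓝 t₀, γ t ∈ e.source ∧ HasDerivAt (fun τ ↦ e (γ τ)) (deriv (fun τ ↦ e (γ τ)) t) t ∧
      HasDerivAt (deriv fun τ ↦ e (γ τ))
        (g.geodesicAccel e (e (γ t)) (deriv (fun τ ↦ e (γ τ)) t)) t := by
  have hc : ContDiffAt ℝ 2 (fun τ ↦ e (γ τ)) t₀ := by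
    rw [← contMDiffAt_iff_contDiffAt]
    exact ((contMDiffAt_of_mem_maximalAtlas he ht₀).of_le
      ENat.LEInfty.out).comp t₀ hγ
  have hsrc : ∀ᶠ t in 𝓝 t₀, γ t ∈ e.source :=
    hγ.continuousAt.eventually (e.open_source.mem_nhds ht₀)
  have hc' : ∀ᶠ t in 𝓝 t₀, ContDiffAt ℝ 2 (fun τ ↦ e (γ τ)) t := hc.eventually (by simp)
  filter_upwards [hgeo, hsrc, hc', hc'.eventually_nhds] with t h1 h2 h3 h4
  have hd : HasDerivAt (fun τ ↦ e (γ τ)) (deriv (fun τ ↦ e (γ τ)) t) t :=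
    (h3.differentiableAt (by simp)).hasDerivAt
  refine ⟨h2, hd, hasDerivAt_euclidean_of_apply fun i ↦ ?_⟩
  -- Components are compared on a neighbourhood of t because they are differentiated once more.
  have hcomp (i : Fin n) : (fun τ ↦ deriv (fun τ ↦ e (γ τ)) τ i) =ᶠ[𝓝 t]
      deriv (fun τ ↦ e (γ τ) i) := by
    filter_upwards [h4] with τ hτ
    exact (hasDerivAt_euclidean_apply (hτ.differentiableAt (by simp)).hasDerivAt i).deriv.symm
  have hdd : DifferentiableAt ℝ (deriv fun τ ↦ e (γ τ)) t :=
    (h3.derivWithin (m := 1) (by norm_num)).differentiableAt (by simp)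
  have := hasDerivAt_euclidean_apply hdd.hasDerivAt i
  convert! this using 1
  rw [← this.deriv, (hcomp i).deriv_eq, geodesicAccel_apply]
  simp only [(hcomp _).eq_of_nhds]
  rw [neg_eq_iff_add_eq_zero, add_comm]
  exact h1 i

omit [IsManifold (𝓡 n) ∞ M] in
theorem coordVector_mfderiv_curve {e : OpenPartialHomeomorph M (EuclideanSpace ℝ (Fin n))}
    (he : e ∈ IsManifold.maximalAtlas (𝓡 n) ∞ M) {γ : ℝ → M} {t : ℝ}
    (hγ : MDifferentiableAt 𝓘(ℝ, ℝ) (𝓡 n) γ t) (ht : γ t ∈ e.source) :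
    coordVector e (γ t) (mfderiv 𝓘(ℝ, ℝ) (𝓡 n) γ t (1 : ℝ)) = deriv (fun τ ↦ e (γ τ)) t := by
  have h : mfderiv 𝓘(ℝ, ℝ) (𝓡 n) (e ∘ γ) t = _ := mfderiv_comp t
    ((contMDiffAt_of_mem_maximalAtlas he ht).mdifferentiableAt (by simp)) hγ
  rw [mfderiv_eq_fderiv] at h
  exact (DFunLike.congr_fun h (1 : ℝ)).symm

/-- The derivatives of a function along a geodesic are given by the covariant derivatives. -/
theorem eventually_iteratedDeriv_eq_covDeriv (g : PseudoRiemannianMetric n M)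
    {e : OpenPartialHomeomorph M (EuclideanSpace ℝ (Fin n))}
    (he : e ∈ IsManifold.maximalAtlas (𝓡 n) ∞ M) {γ : ℝ → M} {t₀ : ℝ}
    (hγ : ContMDiffAt 𝓘(ℝ, ℝ) (𝓡 n) 2 γ t₀) (ht₀ : γ t₀ ∈ e.source)
    (hgeo : ∀ᶠ t in nhds t₀, g.GeodesicEqAt e γ t) {f : M → ℝ} (k : ℕ)
    (hf : ContMDiff (𝓡 n) 𝓘(ℝ, ℝ) k f) :
    ∀ᶠ t in nhds t₀, iteratedDeriv k (fun τ ↦ f (γ τ)) t =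
      ∑ I : Fin k → Fin n, g.covDerivCoord e f k I (e (γ t)) *
        ∏ s, deriv (fun τ ↦ e (γ τ)) t (I s) := by
  have hE := g.eventually_hasDerivAt_of_geodesicEqAt he hγ ht₀ hgeo
  induction k with
  | zero =>
    filter_upwards [hE] with t ht
    simp [covDerivCoord, e.left_inv ht.1]
  | succ k ih =>
    filter_upwards [(ih (hf.of_le (by norm_cast; omega))).eventually_nhds, hE] with t h1 h2
    rw [iteratedDeriv_succ, Filter.EventuallyEq.deriv_eq h1]
    exact (g.hasDerivAt_sum_covDerivCoord he k hf (e.map_source h2.1) h2.2.1 h2.2.2).deriv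

/-- Since γ is only assumed C^2, higher derivatives of f ∘ γ do not come from the chain rule. They
come from the formula D^k f(γ', …, γ'), whose ingredients are differentiable by the geodesic
equation. -/
theorem differentiableAt_iteratedDeriv (g : PseudoRiemannianMetric n M)
    {e : OpenPartialHomeomorph M (EuclideanSpace ℝ (Fin n))}
    (he : e ∈ IsManifold.maximalAtlas (𝓡 n) ∞ M) {γ : ℝ → M} {t₀ : ℝ}
    (hγ : ContMDiffAt 𝓘(ℝ, ℝ) (𝓡 n) 2 γ t₀) (ht₀ : γ t₀ ∈ e.source)
    (hgeo : ∀ᶠ t in nhds t₀, g.GeodesicEqAt e γ t) {f : M → ℝ} (k : ℕ)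
    (hf : ContMDiff (𝓡 n) 𝓘(ℝ, ℝ) (k + 1 : ℕ) f) :
    DifferentiableAt ℝ (iteratedDeriv k fun τ ↦ f (γ τ)) t₀ := by
  have h2 := (g.eventually_hasDerivAt_of_geodesicEqAt he hγ ht₀ hgeo).self_of_nhds
  exact (g.hasDerivAt_sum_covDerivCoord he k hf (e.map_source h2.1) h2.2.1
    h2.2.2).differentiableAt.congr_of_eventuallyEq
    (g.eventually_iteratedDeriv_eq_covDeriv he hγ ht₀ hgeo k (hf.of_le (by norm_cast; omega)))

/-- On null vectors, Gallot's equation reduces to the vanishing of `D^{p+1} f`. -/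
theorem IsGallotSolution.covDeriv_eq_zero {g : PseudoRiemannianMetric n M} {p : ℕ}
    {lam : ℕ → Equiv.Perm (Fin (p + 1)) → ℝ} {f : M → ℝ} (hf : g.IsGallotSolution p lam f)
    {e : OpenPartialHomeomorph M (EuclideanSpace ℝ (Fin n))}
    (he : e ∈ IsManifold.maximalAtlas (𝓡 n) ∞ M) {x : M} (hx : x ∈ e.source)
    {v : TangentSpace (𝓡 n) x} (hv : g.val x v v = 0) :
    g.covDeriv e f (p + 1) x (fun _ ↦ v) = 0 := by
  have h := hf.2 e he x hx fun _ ↦ v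
  rwa [Finset.sum_eq_zero, add_zero] at h
  intro s hs
  refine Finset.sum_eq_zero fun σ _ ↦ ?_
  -- With s ≥ 1 the product of metric factors is nonempty, so it contains g(v, v) = 0.
  have hs1 : s ≠ 0 := by have := (Finset.mem_Icc.1 hs).1; omega
  unfold metricPowTensor
  split_ifs
  · simp [hv, hs1]
  · simp

/-- A solution of Gallot's equation on a closed manifold is constant along every complete
light-line geodesic. -/
theorem IsGallotSolution.eq_along_lightLine [CompactSpace M] {g : PseudoRiemannianMetric n M}
    {p : ℕ} {lam : ℕ → Equiv.Perm (Fin (p + 1)) → ℝ} {f : M → ℝ}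
    (hf : g.IsGallotSolution p lam f) {γ : ℝ → M}
    (hγ : g.IsLightLineGeodesicOn γ Set.univ) (s t : ℝ) : f (γ s) = f (γ t) := by
  -- This is where compactness of M enters.
  obtain ⟨C, hC⟩ := isCompact_univ.exists_bound_of_continuousOn hf.1.continuous.continuousOn
  have hγ2 (t : ℝ) : ContMDiffAt 𝓘(ℝ, ℝ) (𝓡 n) 2 γ t :=
    hγ.1.1.contMDiffAt Filter.univ_mem
  refine eq_of_iteratedDeriv_succ_eq_zero_of_bounded (F := fun τ ↦ f (γ τ)) (p := p)
    (fun k hk t ↦ ?_) (fun t ↦ ?_) (fun t ↦ hC (γ t) trivial) s t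
  · obtain ⟨e, he, ht, hgeo⟩ := hγ.1.2 t trivial
    exact g.differentiableAt_iteratedDeriv he (hγ2 t) ht hgeo k
      (hf.1.of_le (by norm_cast; omega))
  · obtain ⟨e, he, ht, hgeo⟩ := hγ.1.2 t trivial
    rw [(g.eventually_iteratedDeriv_eq_covDeriv he (hγ2 t) ht hgeo (p + 1) hf.1).self_of_nhds,
      ← hf.covDeriv_eq_zero he ht (hγ.2 t trivial), covDeriv,
      coordVector_mfderiv_curve he ((hγ2 t).mdifferentiableAt (by simp)) ht]

/-! ### The signature is indefinite at every point -/

omit [IsManifold (𝓡 n) ∞ M] in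
theorem coordVector_injective {e : OpenPartialHomeomorph M (EuclideanSpace ℝ (Fin n))}
    (he : e ∈ IsManifold.maximalAtlas (𝓡 n) ∞ M) {x : M} (hx : x ∈ e.source) :
    Function.Injective (coordVector e x) :=
  (mdifferentiable_of_mem_maximalAtlas he).mfderiv_injective hx

omit [IsManifold (𝓡 n) ∞ M] in
theorem exists_coordVector_eq {e : OpenPartialHomeomorph M (EuclideanSpace ℝ (Fin n))}
    (he : e ∈ IsManifold.maximalAtlas (𝓡 n) ∞ M) {x : M} (hx : x ∈ e.source)
    (w : EuclideanSpace ℝ (Fin n)) : ∃ v : TangentSpace (𝓡 n) x, coordVector e x v = w :=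
  (mdifferentiable_of_mem_maximalAtlas he).mfderiv_surjective hx w

/-- Nondegeneracy upgrades a failure of definiteness to a strict inequality, which is stable under
perturbation: a null v pairs nontrivially with some w, and moving w along v makes the form negative.
-/
theorem exists_mul_val_neg (g : PseudoRiemannianMetric n M) {x : M} {c : ℝ} (hc : c ≠ 0)
    {v : TangentSpace (𝓡 n) x} (hv : v ≠ 0) (h : c * g.val x v v ≤ 0) :
    ∃ u, c * g.val x u u < 0 := by
  rcases h.lt_or_eq with h | h
  · exact ⟨v, h⟩
  have hvv : g.val x v v = 0 := (mul_eq_zero.1 h).resolve_left hc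
  obtain ⟨w, hw⟩ : ∃ w, g.val x v w ≠ 0 := by
    by_contra! H
    exact hv (g.nondegenerate x v H)
  -- Since v is null, the form c • g is affine in s on w + s v; this s gives it the value -1.
  set s := -(c * g.val x w w + 1) / (2 * c * g.val x v w)
  have hs : s * (2 * c * g.val x v w) = -(c * g.val x w w + 1) :=
    div_mul_cancel₀ _ (by simp [hc, hw])
  refine ⟨w + s • v, ?_⟩
  simp only [map_add, map_smul, add_apply, smul_apply, smul_eq_mul, hvv, g.symm x w v]
  linarith

theorem continuousOn_sum_coordMatrix (g : PseudoRiemannianMetric n M)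
    {e : OpenPartialHomeomorph M (EuclideanSpace ℝ (Fin n))}
    (he : e ∈ IsManifold.maximalAtlas (𝓡 n) ∞ M) :
    ContinuousOn (fun z : EuclideanSpace ℝ (Fin n) × EuclideanSpace ℝ (Fin n) ↦
      ∑ i, ∑ j, g.coordMatrix e z.1 i j * z.2 i * z.2 j) (e.target ×ˢ Set.univ) := by
  refine continuousOn_finsetSum _ fun i _ ↦ continuousOn_finsetSum _ fun j _ ↦
    ContinuousOn.mul (ContinuousOn.mul ?_ ?_) ?_
  · exact (g.contDiffOn_coordMatrix he i j).continuousOn.comp continuousOn_fst fun z hz ↦ hz.1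
  · fun_prop
  · fun_prop

theorem sum_coordMatrix_mul_coordVector (g : PseudoRiemannianMetric n M)
    {e : OpenPartialHomeomorph M (EuclideanSpace ℝ (Fin n))}
    (he : e ∈ IsManifold.maximalAtlas (𝓡 n) ∞ M) {x : M} (hx : x ∈ e.source)
    (v w : TangentSpace (𝓡 n) x) :
    ∑ i, ∑ j, g.coordMatrix e (e x) i j * coordVector e x v i * coordVector e x w j =
      g.val x v w := by
  rw [sum_coordMatrix_mul, mfderiv_symm_coordVector he hx, mfderiv_symm_coordVector he hx,
    e.left_inv hx]

open Filter Topology in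
/-- The set of points where `c • g` is positive definite is open and closed. -/
theorem isClopen_posDef (g : PseudoRiemannianMetric n M) {c : ℝ} (hc : c ≠ 0) :
    IsClopen {x : M | ∀ v : TangentSpace (𝓡 n) x, v ≠ 0 → 0 < c * g.val x v v} := by
  have hcont (x : M) (v : EuclideanSpace ℝ (Fin n)) :
      ContinuousAt (fun z : EuclideanSpace ℝ (Fin n) × EuclideanSpace ℝ (Fin n) ↦
        c * ∑ i, ∑ j, g.coordMatrix (chartAt _ x) z.1 i j * z.2 i * z.2 j)
        (chartAt _ x x, v) :=
    ((g.continuousOn_sum_coordMatrix (IsManifold.chart_mem_maximalAtlas x)).continuousAt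
      (((chartAt _ x).open_target.prod isOpen_univ).mem_nhds
        ⟨mem_chart_target _ x, trivial⟩)).const_mul c
  have hchart (x : M) : ContinuousAt (chartAt (EuclideanSpace ℝ (Fin n)) x) x :=
    (chartAt _ x).continuousAt (mem_chart_source _ x)
  have hsrc (x : M) : ∀ᶠ x' in 𝓝 x, x' ∈ (chartAt (EuclideanSpace ℝ (Fin n)) x).source :=
    (chartAt _ x).open_source.mem_nhds (mem_chart_source _ x)
  constructor
  · rw [← isOpen_compl_iff, isOpen_iff_mem_nhds]
    intro x hx
    simp only [Set.mem_compl_iff, Set.mem_ofPred_eq, not_forall, not_lt] at hx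
    obtain ⟨v, hv, hle⟩ := hx
    obtain ⟨u, hu⟩ := g.exists_mul_val_neg hc hv hle
    have he := IsManifold.chart_mem_maximalAtlas (I := 𝓡 n) (n := ∞) x
    rw [← g.sum_coordMatrix_mul_coordVector he (mem_chart_source _ x)] at hu
    have h1 := (hcont x (coordVector (chartAt _ x) x u)).eventually_lt continuousAt_const hu
    have h2 : ContinuousAt (fun x' ↦ (chartAt (EuclideanSpace ℝ (Fin n)) x x',
        coordVector (chartAt _ x) x u)) x := (hchart x).prodMk continuousAt_const
    filter_upwards [h2.eventually h1, hsrc x] with x' h3 h4 h5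
    obtain ⟨u', hu'⟩ := exists_coordVector_eq he h4 (coordVector (chartAt _ x) x u)
    rw [← hu', g.sum_coordMatrix_mul_coordVector he h4] at h3
    refine absurd h3 (not_lt.2 ?_)
    by_cases h0 : u' = 0
    · simp [h0]
    · exact (h5 u' h0).le
  · rw [isOpen_iff_mem_nhds]
    intro x hx
    have he := IsManifold.chart_mem_maximalAtlas (I := 𝓡 n) (n := ∞) x
    -- Compactness of the unit sphere gives one neighbourhood that works for all unit vectors at
    -- once.
    have h1 : ∀ᶠ y in 𝓝 (chartAt (EuclideanSpace ℝ (Fin n)) x x),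
        ∀ v ∈ Metric.sphere (0 : EuclideanSpace ℝ (Fin n)) 1,
        0 < c * ∑ i, ∑ j, g.coordMatrix (chartAt _ x) y i j * v i * v j := by
      refine (isCompact_sphere _ _).eventually_forall_of_forall_eventually fun v hv ↦ ?_
      refine continuousAt_const.eventually_lt (hcont x v) ?_
      obtain ⟨v, rfl⟩ := exists_coordVector_eq he (mem_chart_source _ x) v
      rw [g.sum_coordMatrix_mul_coordVector he (mem_chart_source _ x)]
      refine hx _ fun h0 ↦ ?_
      have hv0 : coordVector (chartAt (EuclideanSpace ℝ (Fin n)) x) x v = 0 := by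
        rw [h0]
        exact map_zero _
      simp [hv0] at hv
    filter_upwards [(hchart x).eventually h1, hsrc x] with x' h2 h3 v hv
    rw [← g.sum_coordMatrix_mul_coordVector he h3]
    set u := coordVector (chartAt (EuclideanSpace ℝ (Fin n)) x) x' v with hu
    have hu0 : u ≠ 0 := fun h0 ↦ hv (coordVector_injective he h3 (h0.trans (map_zero _).symm))
    have h4 := h2 (‖u‖⁻¹ • u) (by simp [norm_smul, hu0])
    have h5 : c * ∑ i, ∑ j, g.coordMatrix (chartAt _ x) (chartAt _ x x') i j * (‖u‖⁻¹ • u) i *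
        (‖u‖⁻¹ • u) j = (‖u‖⁻¹) ^ 2 * (c * ∑ i, ∑ j,
          g.coordMatrix (chartAt _ x) (chartAt _ x x') i j * u i * u j) := by
      simp only [PiLp.smul_apply, smul_eq_mul, Finset.mul_sum]
      exact Finset.sum_congr rfl fun i _ ↦ Finset.sum_congr rfl fun j _ ↦ by ring
    rw [h5] at h4
    exact pos_of_mul_pos_right h4 (sq_nonneg _)

/-- An indefinite metric on a connected manifold takes both signs at every point. -/
theorem IsIndefinite.exists_mul_val_neg [PreconnectedSpace M] {g : PseudoRiemannianMetric n M}
    (hind : g.IsIndefinite) (x : M) {c : ℝ} (hc : c ≠ 0) :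
    ∃ v : TangentSpace (𝓡 n) x, c * g.val x v v < 0 := by
  by_contra! H
  refine hind c fun y v hv ↦ ?_
  have huniv := (g.isClopen_posDef hc).eq_univ ⟨x, fun v hv ↦ ?_⟩
  · exact (huniv ▸ Set.mem_univ y :
      y ∈ {x : M | ∀ v : TangentSpace (𝓡 n) x, v ≠ 0 → 0 < c * g.val x v v}) v hv
  · by_contra! hle
    obtain ⟨u, hu⟩ := g.exists_mul_val_neg hc hv hle
    exact (H u).not_gt hu

/-! ### Existence of light-line geodesics -/

theorem contDiffOn_geodesicAccel (g : PseudoRiemannianMetric n M)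
    {e : OpenPartialHomeomorph M (EuclideanSpace ℝ (Fin n))}
    (he : e ∈ IsManifold.maximalAtlas (𝓡 n) ∞ M) :
    ContDiffOn ℝ ∞ (fun z : EuclideanSpace ℝ (Fin n) × EuclideanSpace ℝ (Fin n) ↦
      g.geodesicAccel e z.1 z.2) (e.target ×ˢ Set.univ) := by
  rw [contDiffOn_euclidean]
  intro i
  simp only [geodesicAccel_apply]
  refine ContDiffOn.neg (ContDiffOn.sum fun j _ ↦ ContDiffOn.sum fun k _ ↦
    ContDiffOn.mul (ContDiffOn.mul ?_ ?_) ?_)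
  · exact (g.contDiffOn_christoffel he i j k).comp contDiffOn_fst fun z hz ↦ hz.1
  · exact ((EuclideanSpace.proj j : EuclideanSpace ℝ (Fin n) →L[ℝ] ℝ).contDiff.comp
      contDiff_snd).contDiffOn
  · exact ((EuclideanSpace.proj k : EuclideanSpace ℝ (Fin n) →L[ℝ] ℝ).contDiff.comp
      contDiff_snd).contDiffOn

/-- A solution, inside a chart, of the differential equation of the geodesics is a geodesic. -/
theorem isGeodesicOn_of_hasDerivAt (g : PseudoRiemannianMetric n M)
    {e : OpenPartialHomeomorph M (EuclideanSpace ℝ (Fin n))}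
    (he : e ∈ IsManifold.maximalAtlas (𝓡 n) ∞ M) {c w : ℝ → EuclideanSpace ℝ (Fin n)} {J : Set ℝ}
    (hJ : IsOpen J) (hmem : ∀ t ∈ J, c t ∈ e.target) (hc : ∀ t ∈ J, HasDerivAt c (w t) t)
    (hw : ∀ t ∈ J, HasDerivAt w (g.geodesicAccel e (c t) (w t)) t) :
    g.IsGeodesicOn (fun t ↦ e.symm (c t)) J := by
  constructor
  · have hwc : ContDiffOn ℝ 1 w J := by
      rw [show (1 : WithTop ℕ∞) = 0 + 1 by simp, contDiffOn_succ_iff_deriv_of_isOpen hJ]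
      refine ⟨fun t ht ↦ (hw t ht).differentiableAt.differentiableWithinAt, by simp, ?_⟩
      rw [contDiffOn_zero]
      refine ContinuousOn.congr (f := fun t ↦ g.geodesicAccel e (c t) (w t)) ?_
        fun t ht ↦ (hw t ht).deriv
      exact (g.contDiffOn_geodesicAccel he).continuousOn.comp
        (f := fun t ↦ (c t, w t)) (fun t ht ↦
          ((hc t ht).continuousAt.prodMk (hw t ht).continuousAt).continuousWithinAt)
        fun t ht ↦ ⟨hmem t ht, trivial⟩
    have hcc : ContDiffOn ℝ 2 c J := by
      rw [show (2 : WithTop ℕ∞) = 1 + 1 by norm_num, contDiffOn_succ_iff_deriv_of_isOpen hJ]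
      exact ⟨fun t ht ↦ (hc t ht).differentiableAt.differentiableWithinAt, by simp,
        hwc.congr fun t ht ↦ (hc t ht).deriv⟩
    exact ((contMDiffOn_symm_of_mem_maximalAtlas he).of_le ENat.LEInfty.out).comp
      hcc.contMDiffOn hmem
  · intro t₀ ht₀
    refine ⟨e, he, e.map_target (hmem t₀ ht₀), ?_⟩
    filter_upwards [hJ.mem_nhds ht₀] with t ht i
    have h1 : ∀ᶠ τ in nhds t, ∀ j, deriv (fun τ ↦ e (e.symm (c τ)) j) τ = w τ j := by
      filter_upwards [hJ.mem_nhds ht] with τ hτ j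
      have : (fun τ ↦ e (e.symm (c τ)) j) =ᶠ[nhds τ] fun τ ↦ c τ j := by
        filter_upwards [hJ.mem_nhds hτ] with σ hσ
        rw [e.right_inv (hmem σ hσ)]
      rw [this.deriv_eq, (hasDerivAt_euclidean_apply (hc τ hτ) j).deriv]
    have h2 : deriv (deriv fun τ ↦ e (e.symm (c τ)) i) t = g.geodesicAccel e (c t) (w t) i := by
      rw [Filter.EventuallyEq.deriv_eq (f := fun τ ↦ w τ i) (h1.mono fun τ hτ ↦ hτ i),
        (hasDerivAt_euclidean_apply (hw t ht) i).deriv]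
    simp only [h2, h1.self_of_nhds, e.right_inv (hmem t ht), geodesicAccel_apply]
    exact neg_add_cancel _

/-- A solution, inside a chart, of the differential equation of the geodesics whose velocity is null
at some time is a light-line geodesic. -/
theorem isLightLineGeodesicOn_of_hasDerivAt (g : PseudoRiemannianMetric n M)
    {e : OpenPartialHomeomorph M (EuclideanSpace ℝ (Fin n))}
    (he : e ∈ IsManifold.maximalAtlas (𝓡 n) ∞ M) {c w : ℝ → EuclideanSpace ℝ (Fin n)} {J : Set ℝ}
    (hJ : IsOpen J) (hJ' : IsPreconnected J) (hmem : ∀ t ∈ J, c t ∈ e.target)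
    (hc : ∀ t ∈ J, HasDerivAt c (w t) t)
    (hw : ∀ t ∈ J, HasDerivAt w (g.geodesicAccel e (c t) (w t)) t) {t₀ : ℝ} (ht₀ : t₀ ∈ J)
    (hnull : ∑ i, ∑ j, g.coordMatrix e (c t₀) i j * w t₀ i * w t₀ j = 0) :
    g.IsLightLineGeodesicOn (fun t ↦ e.symm (c t)) J := by
  have hgeo := g.isGeodesicOn_of_hasDerivAt he hJ hmem hc hw
  refine ⟨hgeo, fun t ht ↦ ?_⟩
  have hnull' : ∑ i, ∑ j, g.coordMatrix e (c t) i j * w t i * w t j = 0 := by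
    have hd (τ : ℝ) (hτ : τ ∈ J) :=
      g.hasDerivAt_sum_coordMatrix he (hmem τ hτ) (hc τ hτ) (hw τ hτ)
    rw [← hnull]
    exact hJ.is_const_of_deriv_eq_zero hJ'
      (fun τ hτ ↦ (hd τ hτ).differentiableAt.differentiableWithinAt)
      (fun τ hτ ↦ (hd τ hτ).deriv) ht ht₀
  have hsrc : e.symm (c t) ∈ e.source := e.map_target (hmem t ht)
  have hγ : MDifferentiableAt 𝓘(ℝ, ℝ) (𝓡 n) (fun t ↦ e.symm (c t)) t :=
    (hgeo.1.contMDiffAt (hJ.mem_nhds ht)).mdifferentiableAt (by simp)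
  have hderiv : deriv (fun τ ↦ e (e.symm (c τ))) t = w t := by
    have : (fun τ ↦ e (e.symm (c τ))) =ᶠ[nhds t] c := by
      filter_upwards [hJ.mem_nhds ht] with τ hτ
      rw [e.right_inv (hmem τ hτ)]
    rw [this.deriv_eq, (hc t ht).deriv]
  rw [← g.sum_coordMatrix_mul_coordVector he hsrc, coordVector_mfderiv_curve he hγ hsrc, hderiv,
    e.right_inv (hmem t ht), hnull']

/-- Existence of geodesics with a prescribed null initial velocity. -/
theorem exists_isLightLineGeodesicOn (g : PseudoRiemannianMetric n M)
    {e : OpenPartialHomeomorph M (EuclideanSpace ℝ (Fin n))}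
    (he : e ∈ IsManifold.maximalAtlas (𝓡 n) ∞ M) {y v : EuclideanSpace ℝ (Fin n)}
    (hy : y ∈ e.target) (hv : ∑ i, ∑ j, g.coordMatrix e y i j * v i * v j = 0) :
    ∃ δ > 0, ∃ c : ℝ → EuclideanSpace ℝ (Fin n), c 0 = y ∧ HasDerivAt c v 0 ∧
      g.IsLightLineGeodesicOn (fun t ↦ e.symm (c t)) (Metric.ball 0 δ) := by
  have hmem : e.target ×ˢ Set.univ ∈ nhds (y, v) :=
    (e.open_target.prod isOpen_univ).mem_nhds ⟨hy, trivial⟩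
  -- Picard–Lindelöf for the first-order system in (position, velocity); δ below is chosen so that
  -- the solution stays in the chart.
  obtain ⟨α, hα0, ε, hε, hα⟩ :=
    ContDiffAt.exists_forall_mem_closedBall_exists_eq_forall_mem_Ioo_hasDerivAt₀
      (f := fun z : EuclideanSpace ℝ (Fin n) × EuclideanSpace ℝ (Fin n) ↦
        (z.2, g.geodesicAccel e z.1 z.2)) (x₀ := (y, v))
      (contDiffAt_snd.prodMk (((g.contDiffOn_geodesicAccel he).contDiffAt hmem).of_le
        ENat.LEInfty.out)) 0
  have hev : ∀ᶠ t in nhds (0 : ℝ), α t ∈ e.target ×ˢ Set.univ ∧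
      HasDerivAt α ((α t).2, g.geodesicAccel e (α t).1 (α t).2) t := by
    refine Filter.Eventually.and ?_ ?_
    · have := (hα 0 (by simp [hε])).continuousAt
      exact this.eventually (by rwa [hα0])
    · filter_upwards [Ioo_mem_nhds (a := (0 : ℝ) - ε) (b := 0 + ε) (x := 0) (by linarith)
        (by linarith)] with t ht using hα t ht
  obtain ⟨δ, hδ, hball⟩ := Metric.eventually_nhds_iff_ball.1 hev
  have hc (t : ℝ) (ht : t ∈ Metric.ball 0 δ) : HasDerivAt (fun t ↦ (α t).1) (α t).2 t :=
    (hball t ht).2.fst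
  have hw (t : ℝ) (ht : t ∈ Metric.ball 0 δ) :
      HasDerivAt (fun t ↦ (α t).2) (g.geodesicAccel e (α t).1 (α t).2) t :=
    (hball t ht).2.snd
  have h0 := Metric.mem_ball_self (x := (0 : ℝ)) hδ
  refine ⟨δ, hδ, fun t ↦ (α t).1, congrArg Prod.fst hα0, by simpa [hα0] using hc 0 h0,
    g.isLightLineGeodesicOn_of_hasDerivAt he Metric.isOpen_ball
      (convex_ball (0 : ℝ) δ).isPreconnected (fun t ht ↦ (hball t ht).1.1) hc hw h0 ?_⟩
  simpa only [hα0] using hv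

/-! ### Vanishing of the differential -/

/-- A function on a light-line-complete manifold which is constant along the complete light-line
geodesics has vanishing differential in the null directions. -/
theorem IsLightLineComplete.fderiv_apply_eq_zero {g : PseudoRiemannianMetric n M}
    (hcomplete : g.IsLightLineComplete) {f : M → ℝ}
    (hf : ∀ γ : ℝ → M, g.IsLightLineGeodesicOn γ Set.univ → ∀ s t, f (γ s) = f (γ t))
    {e : OpenPartialHomeomorph M (EuclideanSpace ℝ (Fin n))}
    (he : e ∈ IsManifold.maximalAtlas (𝓡 n) ∞ M) {y v : EuclideanSpace ℝ (Fin n)}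
    (hy : y ∈ e.target) (hfd : DifferentiableAt ℝ (fun z ↦ f (e.symm z)) y)
    (hv : ∑ i, ∑ j, g.coordMatrix e y i j * v i * v j = 0) :
    fderiv ℝ (fun z ↦ f (e.symm z)) y v = 0 := by
  obtain ⟨δ, hδ, c, rfl, hc', hc⟩ := g.exists_isLightLineGeodesicOn he hy hv
  obtain ⟨γ, hγ, hγc⟩ := hcomplete _ _ Metric.isOpen_ball (convex_ball (0 : ℝ) δ).ordConnected
    (Metric.nonempty_ball.2 hδ) hc
  have h1 : HasDerivAt (fun t ↦ f (e.symm (c t))) (fderiv ℝ (fun z ↦ f (e.symm z)) (c 0) v) 0 :=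
    hfd.hasFDerivAt.comp_hasDerivAt 0 hc'
  have h2 : (fun t ↦ f (e.symm (c t))) =ᶠ[nhds 0] fun _ ↦ f (γ 0) := by
    filter_upwards [Metric.ball_mem_nhds 0 hδ] with t ht
    have : γ t = e.symm (c t) := hγc ht
    rw [← this]
    exact hf γ hγ t 0
  rw [← h1.deriv, h2.deriv_eq, deriv_const]

/-- A differentiable function on a connected, indefinite, light-line-complete manifold which is
constant along the complete light-line geodesics is constant. -/
theorem IsLightLineComplete.eq_of_eq_along_lightLine [PreconnectedSpace M]
    {g : PseudoRiemannianMetric n M} (hind : g.IsIndefinite) (hcomplete : g.IsLightLineComplete)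
    {f : M → ℝ} (hfd : ContMDiff (𝓡 n) 𝓘(ℝ, ℝ) 1 f)
    (hf : ∀ γ : ℝ → M, g.IsLightLineGeodesicOn γ Set.univ → ∀ s t, f (γ s) = f (γ t)) (x y : M) :
    f x = f y := by
  refine IsLocallyConstant.apply_eq_of_preconnectedSpace ?_ x y
  rw [IsLocallyConstant.iff_eventually_eq]
  intro x
  set e := chartAt (EuclideanSpace ℝ (Fin n)) x
  have he : e ∈ IsManifold.maximalAtlas (𝓡 n) ∞ M := IsManifold.chart_mem_maximalAtlas x
  have hdiff : DifferentiableOn ℝ (fun z ↦ f (e.symm z)) e.target :=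
    (contMDiffOn_iff_contDiffOn.1 (hfd.comp_contMDiffOn
      ((contMDiffOn_symm_of_mem_maximalAtlas he).of_le ENat.LEInfty.out))).differentiableOn
      (by simp)
  have hzero (y : EuclideanSpace ℝ (Fin n)) (hy : y ∈ e.target) :
      fderiv ℝ (fun z ↦ f (e.symm z)) y = 0 := by
    let B : LinearMap.BilinForm ℝ (EuclideanSpace ℝ (Fin n)) := LinearMap.mk₂ ℝ
      (fun v w ↦ ∑ i, ∑ j, g.coordMatrix e y i j * v i * w j)
      (fun _ _ _ ↦ by simp [mul_add, add_mul, Finset.sum_add_distrib])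
      (fun _ _ _ ↦ by simp [Finset.mul_sum, mul_assoc, mul_left_comm])
      (fun _ _ _ ↦ by simp [mul_add, Finset.sum_add_distrib])
      (fun _ _ _ ↦ by simp [Finset.mul_sum, mul_left_comm])
    have hB (v w : EuclideanSpace ℝ (Fin n)) :
        B v w = ∑ i, ∑ j, g.coordMatrix e y i j * v i * w j := rfl
    have hsign (c : ℝ) (hc : c ≠ 0) : ∃ v, c * B v v < 0 := by
      obtain ⟨v, hv⟩ := hind.exists_mul_val_neg (e.symm y) hc
      refine ⟨coordVector e (e.symm y) v, ?_⟩
      have h := g.sum_coordMatrix_mul_coordVector he (e.map_target hy) v v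
      rw [e.right_inv hy] at h
      rwa [hB, h]
    obtain ⟨a, ha⟩ := hsign 1 one_ne_zero
    obtain ⟨b, hb⟩ := hsign (-1) (by norm_num)
    have := B.eq_zero_of_null (fun v w ↦ by
      rw [hB, hB, Finset.sum_comm]
      refine Finset.sum_congr rfl fun i _ ↦ Finset.sum_congr rfl fun j _ ↦ ?_
      rw [g.coordMatrix_symm]
      ring) (fderiv ℝ (fun z ↦ f (e.symm z)) y).toLinearMap
      (fun v hv ↦ hcomplete.fderiv_apply_eq_zero hf he hy
        ((hdiff y hy).differentiableAt (e.open_target.mem_nhds hy)) hv)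
      (by linarith : B a a < 0) (by linarith : 0 < B b b)
    ext v
    exact LinearMap.congr_fun this v
  have hx : x ∈ e.source := mem_chart_source _ x
  -- The chart target need not be connected, so constancy is deduced on a ball inside it.
  obtain ⟨δ, hδ, hball⟩ := Metric.isOpen_iff.1 e.open_target (e x) (e.map_source hx)
  filter_upwards [e.open_source.mem_nhds hx,
    (e.continuousAt hx).eventually (Metric.ball_mem_nhds (e x) hδ)] with x' hx' hx'δ
  have := Metric.isOpen_ball.is_const_of_fderiv_eq_zero (convex_ball (e x) δ).isPreconnected
    (hdiff.mono hball) (fun y hy ↦ hzero y (hball hy)) hx'δ (Metric.mem_ball_self hδ)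
  simpa only [e.left_inv hx', e.left_inv hx] using this

end PseudoRiemannianMetric

theorem theorem3 {n : ℕ} {M : Type*} [TopologicalSpace M] [T2Space M] [CompactSpace M]
    [ConnectedSpace M] [ChartedSpace (EuclideanSpace ℝ (Fin n)) M] [IsManifold (𝓡 n) ∞ M]
    (g : PseudoRiemannianMetric n M) (hind : g.IsIndefinite) (hcomplete : g.IsLightLineComplete)
    (p : ℕ) (lam : ℕ → Equiv.Perm (Fin (p + 1)) → ℝ) (f : M → ℝ)
    (hf : g.IsGallotSolution p lam f) :
    ∃ c : ℝ, ∀ x, f x = c := by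
  obtain ⟨x₀⟩ := (inferInstance : Nonempty M)
  exact ⟨f x₀, fun x ↦ hcomplete.eq_of_eq_along_lightLine hind
    (hf.1.of_le (by norm_cast; omega)) (fun _ hγ s t ↦ hf.eq_along_lightLine hγ s t) x x₀⟩
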